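/- Conventions. For a language $L\subseteq\{0,1\}^*$ and $n\in\mathbb N$ let $P(L(n))\subseteq\mathbb R^n$ be the convex hull of the strings of length $n$ in $L$, viewed as $0/1$ vectors. The size of a polytope is the smallest number of linear inequalities that define it, and the extension complexity $\mathrm{xc}(P)$ of a polytope $P$ is the smallest size of a polytope $Q$ (in a space of any dimension) of which $P$ is the image under an affine map. Let $\mathcal{CF}$ be the class of languages $L\subseteq\{0,1\}^*$ for which there are $c>0$ and $n_0\in\mathbb N$ such that $\mathrm{xc}(P(L(n)))\le n^c$ for all $n\ge n_0$. A nondeterministic online Turing machine has finitely many states, a read-only input tape holding the input followed by an end marker, and a work tape over a finite alphabet, initially blank. In each step it may, depending on its state and on the two symbols read, change its state, overwrite the work symbol, move the work head by at most one cell in either direction, and either leave the input head in place, move it one cell to the right, or put it back on the first input cell, which begins a new pass over the input. It accepts by halting in an accepting state. A language $L$ is accepted by such a machine in $k$ passes and space $s(n)$ if no string outside $L$ has an accepting computation and every string $x\in L$ of length $n$ has an accepting computation that makes at most $k$ passes over the input and visits at most $s(n)$ cells of the work tape. Corollary (fixed-pass nondeterministic LOGSPACE $\Rightarrow\mathcal{CF}$).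 Let $k\in\mathbb N$ be a constant and let $s:\mathbb N\to\mathbb N$ satisfy $s(n)=\mathcal O(\log n)$. If a language $L\subseteq\{0,1\}^*$ is accepted by a nondeterministic online Turing machine in $k$ passes and space $s(n)$, then $L\in\mathcal{CF}$. -/

import Mathlib

namespace CompactEF

/-! ### Polytopes and extension complexity -/

/-- The set of points satisfying the `m` linear inequalities `A x ≤ b` in `ℝ^d`. -/
def polyhedron {m d : ℕ} (A : Matrix (Fin m) (Fin d) ℝ) (b : Fin m → ℝ) : Set (Fin d → ℝ) :=
  {x | ∀ i, A.mulVec x i ≤ b i}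

/-- A polytope is a bounded set that is defined by finitely many linear inequalities. -/
def IsPolytope {d : ℕ} (Q : Set (Fin d → ℝ)) : Prop :=
  Bornology.IsBounded Q ∧
    ∃ (m : ℕ) (A : Matrix (Fin m) (Fin d) ℝ) (b : Fin m → ℝ), Q = polyhedron A b

/-- The size of a polytope: the smallest number of inequalities that define it. -/
noncomputable def polytopeSize {d : ℕ} (Q : Set (Fin d → ℝ)) : ℕ∞ :=
  sInf {r | ∃ (m : ℕ) (A : Matrix (Fin m) (Fin d) ℝ) (b : Fin m → ℝ),
    Q = polyhedron A b ∧ r = (m : ℕ∞)}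

/-- `Q` is an extended formulation of `P`: a polytope that projects onto `P`. Projections are
affine maps, so that an extended formulation may always be taken full-dimensional in its own
space; linear equations therefore contribute nothing to the extension complexity. -/
def IsExtendedFormulation {d n : ℕ} (Q : Set (Fin d → ℝ)) (P : Set (Fin n → ℝ)) : Prop :=
  IsPolytope Q ∧ ∃ π : (Fin d → ℝ) →ᵃ[ℝ] (Fin n → ℝ), π '' Q = P

/-- The extension complexity: the smallest size of an extended formulation
(`⊤` if there is none). -/
noncomputable def extensionComplexity {n : ℕ} (P : Set (Fin n → ℝ)) : ℕ∞ :=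
  sInf {r | ∃ (d : ℕ) (Q : Set (Fin d → ℝ)), IsExtendedFormulation Q P ∧ r = polytopeSize Q}

/-! ### Polytopes of languages and the class of compact languages -/

/-- A binary string of length `n` as a `0/1` vector. -/
def bitVector {n : ℕ} (x : Fin n → Bool) : Fin n → ℝ := fun i => if x i then 1 else 0

/-- `P(L(n))`: the convex hull of the strings of length `n` in `L`. -/
def languagePolytope (L : Language Bool) (n : ℕ) : Set (Fin n → ℝ) :=
  convexHull ℝ {v | ∃ x : Fin n → Bool, List.ofFn x ∈ L ∧ v = bitVector x}

/-- The class of languages that admit compact extended formulations: the extension complexity of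
`P(L(n))` is at most `n ^ c` for a constant `c` and all sufficiently large `n`. -/
def CF : Set (Language Bool) :=
  {L | ∃ c : ℕ, 0 < c ∧ ∃ n₀ : ℕ, ∀ n : ℕ, n₀ ≤ n →
    extensionComplexity (languagePolytope L n) ≤ ((n ^ c : ℕ) : ℕ∞)}

/-! ### Online Turing machines -/

/-- Moves of the one-way input head: stay, go one cell to the right, or go back to the
first cell, which starts a new pass over the input. -/
inductive InputMove where
  | stay
  | right
  | restart

/-- Moves of the head on the work tape. -/
inductive WorkMove where
  | left
  | stay
  | right

/-- A nondeterministic online Turing machine with a read-only input tape and one work tape.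
`next q a g` is the set of possible actions in state `q` when the input head reads `a` (`none`
is the end marker to the right of the input) and the work head reads `g`: the new state, the
symbol written on the work tape, and the moves of the two heads. -/
structure OnlineNTM where
  State : Type
  Symbol : Type
  finiteState : Finite State
  finiteSymbol : Finite Symbol
  start : State
  blank : Symbol
  accepting : Set State
  next : State → Option Bool → Symbol → Set (State × Symbol × InputMove × WorkMove)

namespace OnlineNTM

/-- A configuration. The work tape is infinite to the right. `pass` is the number of the current
pass over the input, counted from `1`. -/
structure Config (M : OnlineNTM) where
  state : M.State
  inputPos : ℕ
  pass : ℕ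
  tape : ℕ → M.Symbol
  head : ℕ

/-- The initial configuration. -/
def initial (M : OnlineNTM) : M.Config where
  state := M.start
  inputPos := 0
  pass := 1
  tape := fun _ => M.blank
  head := 0

/-- The input head moves on the cells `0, …, n`, where `n` is the length of the input and
cell `n` holds the end marker, which cannot be passed. -/
def moveInput (n i : ℕ) : InputMove → ℕ
  | .stay => i
  | .right => min (i + 1) n
  | .restart => 0

/-- The number of the pass after a move of the input head. -/
def movePass (p : ℕ) : InputMove → ℕ
  | .stay => p
  | .right => p
  | .restart => p + 1

/-- The position of the work head after a move; on the leftmost cell, `left` has no effect. -/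
def moveWork (h : ℕ) : WorkMove → ℕ
  | .left => h - 1
  | .stay => h
  | .right => h + 1

/-- The result of performing an action in configuration `c`, on an input of length `n`. -/
def perform (M : OnlineNTM) (n : ℕ) (c : M.Config)
    (a : M.State × M.Symbol × InputMove × WorkMove) : M.Config where
  state := a.1
  inputPos := moveInput n c.inputPos a.2.2.1
  pass := movePass c.pass a.2.2.1
  tape := Function.update c.tape c.head a.2.1
  head := moveWork c.head a.2.2.2

/-- The actions that are possible in configuration `c` on input `x`. -/
def actions (M : OnlineNTM) (x : List Bool) (c : M.Config) :
    Set (M.State × M.Symbol × InputMove × WorkMove) :=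
  M.next c.state x[c.inputPos]? (c.tape c.head)

/-- One step of the machine on input `x`. -/
def Step (M : OnlineNTM) (x : List Bool) (c c' : M.Config) : Prop :=
  ∃ a ∈ M.actions x c, c' = M.perform x.length c a

/-- `c 0, …, c t` is an accepting computation on `x`: it starts in the initial configuration and
halts, that is, no action is possible in `c t`, in an accepting state. -/
def IsAcceptingRun (M : OnlineNTM) (x : List Bool) (t : ℕ) (c : ℕ → M.Config) : Prop :=
  c 0 = M.initial ∧ (∀ i < t, M.Step x (c i) (c (i + 1))) ∧
    M.actions x (c t) = ∅ ∧ (c t).state ∈ M.accepting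

/-- Some sequence of nondeterministic choices leads to acceptance of `x`. -/
def Accepts (M : OnlineNTM) (x : List Bool) : Prop :=
  ∃ (t : ℕ) (c : ℕ → M.Config), M.IsAcceptingRun x t c

/-- Some accepting computation on `x` makes at most `k` passes over the input and visits only the
first `s` cells of the work tape. -/
def AcceptsWithin (M : OnlineNTM) (x : List Bool) (k s : ℕ) : Prop :=
  ∃ (t : ℕ) (c : ℕ → M.Config), M.IsAcceptingRun x t c ∧
    ∀ i ≤ t, (c i).pass ≤ k ∧ (c i).head < s

end OnlineNTM

/-- The class of languages accepted by `k`-pass nondeterministic online Turing machines that use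
space `s(n)`. Strings outside of `L` have no accepting computation, and every string of length `n`
in `L` has one with at most `k` passes and `s n` work tape cells. (In particular, this covers the
machines all of whose computations obey the two bounds.) -/
def NSPACE (k : ℕ) (s : ℕ → ℕ) : Set (Language Bool) :=
  {L | ∃ M : OnlineNTM, (∀ x : List Bool, x ∈ L ↔ M.Accepts x) ∧
    ∀ x : List Bool, x ∈ L → M.AcceptsWithin x k (s x.length)}

end CompactEF

namespace CompactEF

/-! In space `s` a machine has at most `|State| * |Symbol| ^ s * s` memory contents, which is
polynomial in `n` when `s = O(log n)`. Guess in advance the memory content at each restart. Given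
these guesses, the `k` passes no longer depend on each other, so a single left-to-right scan can
check them all in parallel. This is an NFA (`passAutomaton`) with polynomially many states, as `k`
is constant. It depends on `n` through `s n` and agrees with `L` on strings of length `n`: a bounded
accepting computation can be cut into passes, and conversely matching passes glue to an accepting
computation (`mem_accepts_passAutomaton_iff`).

For an NFA, accepting runs of length `n` are source-to-sink paths in a layered graph. The unit flows
on this graph form a polytope with polynomially many inequalities, and reading off the flow on the
edges with letter `1` in each layer maps it onto the convex hull of the accepted strings
(`flowBits_image_isUnitFlow`). A path gives a flow. The converse is flow decomposition, done layer
by layer without listing paths: each state `q` carries a point of the cone over the strings that can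
lead to `q`, whose height is the flow into `q`. This point is split in proportion to the outgoing
flow, and the next bit is overwritten. -/

/-- A bounded system of linear inequalities indexed by finite types bounds the extension complexity
of its linear images by the number of inequalities. -/
theorem extensionComplexity_le_card {n : ℕ} {ι κ : Type*} [Fintype ι] [Fintype κ]
    (f : κ → (ι → ℝ) →ₗ[ℝ] ℝ) (b : κ → ℝ) (π : (ι → ℝ) →ₗ[ℝ] (Fin n → ℝ))
    (hbd : ∀ y, (∀ k, f k y ≤ b k) → ∀ i, |y i| ≤ 1) :
    extensionComplexity (π '' {y | ∀ k, f k y ≤ b k}) ≤ (Fintype.card κ : ℕ∞) := by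
  classical
  let eι := Fintype.equivFin ι
  let eκ := Fintype.equivFin κ
  let g : (Fin (Fintype.card ι) → ℝ) →ₗ[ℝ] (ι → ℝ) := LinearMap.funLeft ℝ ℝ eι
  let A := LinearMap.toMatrix' (LinearMap.pi fun r => f (eκ.symm r) ∘ₗ g)
  let β : Fin (Fintype.card κ) → ℝ := fun r => b (eκ.symm r)
  have hmem : ∀ z, z ∈ polyhedron A β ↔ ∀ k, f k (g z) ≤ b k := by
    intro z
    simp only [polyhedron, Set.mem_ofPred_eq, A, LinearMap.toMatrix'_mulVec, β]
    exact ⟨fun h k => by simpa using h (eκ k), fun h r => h _⟩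
  have hbounded : Bornology.IsBounded (polyhedron A β) := by
    refine (Metric.isBounded_closedBall (x := (0 : Fin (Fintype.card ι) → ℝ)) (r := 1)).subset ?_
    intro z hz
    rw [mem_closedBall_zero_iff, pi_norm_le_iff_of_nonneg zero_le_one]
    intro j
    simpa [g, LinearMap.funLeft_apply] using hbd _ ((hmem z).1 hz) (eι.symm j)
  have himage : (π ∘ₗ g).toAffineMap '' polyhedron A β = π '' {y | ∀ k, f k y ≤ b k} := by
    ext v
    constructor
    · rintro ⟨z, hz, rfl⟩
      exact ⟨g z, (hmem z).1 hz, rfl⟩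
    · rintro ⟨y, hy, rfl⟩
      have hg : g (y ∘ eι.symm) = y := by
        ext i; simp [g, LinearMap.funLeft_apply]
      exact ⟨y ∘ eι.symm, (hmem _).2 (by rwa [hg]), by simp [hg]⟩
  refine le_trans (sInf_le ⟨_, _, ⟨⟨hbounded, _, _, _, rfl⟩, _, himage⟩, rfl⟩) ?_
  exact sInf_le ⟨_, _, _, rfl, rfl⟩

/-! ### Cones over convex hulls -/

/-- A nonzero point of the cone over `S × {1}` has positive height, and scaling it to height `1`
gives a point of the convex hull of `S`. -/
theorem eq_zero_or_of_mem_hull {E : Type*} [AddCommGroup E] [Module ℝ E] {S : Set E} {p : ℝ × E}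
    (hp : p ∈ PointedCone.hull ℝ ((fun w => ((1 : ℝ), w)) '' S)) :
    p = 0 ∨ 0 < p.1 ∧ ∃ w ∈ convexHull ℝ S, p.2 = p.1 • w := by
  induction hp using Submodule.span_induction with
  | mem p hp =>
    obtain ⟨w, hw, rfl⟩ := hp
    exact Or.inr ⟨one_pos, w, subset_convexHull ℝ S hw, by simp⟩
  | zero => exact Or.inl rfl
  | add p q _ _ hp hq =>
    rcases hp with rfl | ⟨hp, u, hu, hpu⟩
    · simpa using hq
    rcases hq with rfl | ⟨hq, w, hw, hqw⟩
    · rw [add_zero]; exact Or.inr ⟨hp, u, hu, hpu⟩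
    have hpq : 0 < p.1 + q.1 := add_pos hp hq
    refine Or.inr ⟨hpq, _, convex_convexHull ℝ S hu hw (div_nonneg hp.le hpq.le)
      (div_nonneg hq.le hpq.le) (by field_simp), ?_⟩
    rw [Prod.snd_add, Prod.fst_add, hpu, hqw, smul_add, smul_smul, smul_smul,
      mul_div_cancel₀ _ hpq.ne', mul_div_cancel₀ _ hpq.ne']
  | smul a p _ hp =>
    rcases hp with rfl | ⟨hp, u, hu, hpu⟩
    · exact Or.inl (smul_zero _)
    rcases eq_or_lt_of_le a.2 with ha | ha
    · left
      have : a = 0 := Subtype.ext ha.symm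
      rw [this, zero_smul]
    · refine Or.inr ⟨?_, u, hu, ?_⟩
      · exact mul_pos ha hp
      · change (a : ℝ) • p.2 = ((a : ℝ) * p.1) • u
        rw [hpu, smul_smul]

/-- The points of height `1` of the cone over `S × {1}` form the convex hull of `S`. -/
theorem snd_mem_convexHull_of_mem_hull {E : Type*} [AddCommGroup E] [Module ℝ E] {S : Set E}
    {p : ℝ × E} (hp : p ∈ PointedCone.hull ℝ ((fun w => ((1 : ℝ), w)) '' S)) (h1 : p.1 = 1) :
    p.2 ∈ convexHull ℝ S := by
  rcases eq_zero_or_of_mem_hull hp with rfl | ⟨-, w, hw, hv⟩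
  · exact absurd h1 zero_ne_one
  · simpa [hv, h1] using hw

/-! ### The flow formulation for strings accepted by an automaton -/

section NFAPolytope

variable {σ : Type} (M : NFA Bool σ)

theorem mem_evalFrom_ofFn_iff {n : ℕ} (x : Fin n → Bool) (s q : σ) :
    q ∈ M.evalFrom {s} (List.ofFn x) ↔ ∃ β : ℕ → σ, β 0 = s ∧ β n = q ∧
      ∀ j : Fin n, β (j + 1) ∈ M.step (β j) (x j) := by
  induction n generalizing s with
  | zero =>
    simp only [List.ofFn_zero, NFA.evalFrom_nil, Set.mem_singleton_iff]
    exact ⟨fun h => ⟨fun _ => s, rfl, h.symm, fun j => j.elim0⟩, fun ⟨β, h0, h1, _⟩ => by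
      rw [← h1, h0]⟩
  | succ n ih =>
    rw [List.ofFn_succ, NFA.evalFrom_cons, NFA.stepSet_singleton, NFA.mem_evalFrom_iff_exists]
    constructor
    · rintro ⟨t, ht, hq⟩
      obtain ⟨β, rfl, hn, hstep⟩ := (ih _ _).1 hq
      refine ⟨fun j => Nat.casesOn j s β, rfl, hn, fun j => ?_⟩
      refine Fin.cases ?_ (fun j => ?_) j
      · exact ht
      · simpa using hstep j
    · rintro ⟨β, rfl, hn, hstep⟩
      exact ⟨β 1, by simpa using hstep 0, (ih _ _).2 ⟨fun j => β (j + 1), rfl, hn,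
        fun j => by simpa using hstep j.succ⟩⟩

theorem ofFn_mem_accepts_iff {n : ℕ} (x : Fin n → Bool) :
    List.ofFn x ∈ M.accepts ↔ ∃ β : ℕ → σ, β 0 ∈ M.start ∧ β n ∈ M.accept ∧
      ∀ j : Fin n, β (j + 1) ∈ M.step (β j) (x j) := by
  rw [NFA.mem_accepts]
  constructor
  · rintro ⟨q, hq, h⟩
    obtain ⟨s, hs, h⟩ := NFA.mem_evalFrom_iff_exists.1 h
    obtain ⟨β, rfl, rfl, hstep⟩ := (mem_evalFrom_ofFn_iff M x s q).1 h
    exact ⟨β, hs, hq, hstep⟩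
  · rintro ⟨β, hs, hq, h⟩
    exact ⟨_, hq, NFA.mem_evalFrom_iff_exists.2
      ⟨_, hs, (mem_evalFrom_ofFn_iff M x _ _).2 ⟨β, rfl, rfl, h⟩⟩⟩

/-- The `0/1` vectors of the strings whose first `i` bits can take `M` from a start state
to `q`. -/
def reachVectors (n i : ℕ) (q : σ) : Set (Fin n → ℝ) :=
  {v | ∃ x : Fin n → Bool, (∃ β : ℕ → σ, β 0 ∈ M.start ∧ β i = q ∧
    ∀ j : Fin n, (j : ℕ) < i → β (j + 1) ∈ M.step (β j) (x j)) ∧ v = bitVector x}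

/-- The cone over `reachVectors`. -/
noncomputable def reachCone (n i : ℕ) (q : σ) : PointedCone ℝ (ℝ × (Fin n → ℝ)) :=
  PointedCone.hull ℝ ((fun w => ((1 : ℝ), w)) '' reachVectors M n i q)

/-- The edges of the layered graph of the runs of length `n`: position, source, letter, target. -/
abbrev Edge (σ : Type) (n : ℕ) : Type := Fin n × σ × Bool × σ

/-- The edges that may occur on an accepting run. -/
def IsValidEdge {m : ℕ} (e : Edge σ (m + 1)) : Prop :=
  e.2.2.2 ∈ M.step e.2.1 e.2.2.1 ∧ (e.1 = 0 → e.2.1 ∈ M.start) ∧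
    (e.1 = Fin.last m → e.2.2.2 ∈ M.accept)

open Classical in
/-- The capacity of an edge. -/
noncomputable def capacity {m : ℕ} (e : Edge σ (m + 1)) : ℝ := if IsValidEdge M e then 1 else 0

/-- The linear map that overwrites bit `i` by the letter `b` on the cone over the strings. -/
noncomputable def setBit {n : ℕ} (i : Fin n) (b : Bool) :
    (ℝ × (Fin n → ℝ)) →ₗ[ℝ] (ℝ × (Fin n → ℝ)) where
  toFun p := (p.1, Function.update p.2 i (if b then p.1 else 0))
  map_add' p q := by
    refine Prod.ext rfl (funext fun j => ?_)
    by_cases h : j = i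
    · subst h; cases b <;> simp
    · simp [h]
  map_smul' r p := by
    refine Prod.ext rfl (funext fun j => ?_)
    by_cases h : j = i
    · subst h; cases b <;> simp
    · simp [h]

/-- Bits from position `i` on are unconstrained in `reachVectors`, so changing bit `i` keeps the run
up to `q` valid, and the run extends by `q'`. Since `setBit` writes the height instead of `1`, it is
linear, and checking generators suffices. -/
theorem setBit_mem_reachCone {n : ℕ} {i : Fin n} {b : Bool} {q q' : σ} (hq : q' ∈ M.step q b)
    {p : ℝ × (Fin n → ℝ)} (hp : p ∈ reachCone M n i q) :
    setBit i b p ∈ reachCone M n (i + 1) q' := by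
  induction hp using Submodule.span_induction with
  | mem p hp =>
    obtain ⟨_, ⟨x, ⟨β, h0, hi, hstep⟩, rfl⟩, rfl⟩ := hp
    refine Submodule.subset_span ⟨_, ⟨Function.update x i b,
      ⟨Function.update β (i + 1) q', ?_, by simp, fun j hj => ?_⟩, rfl⟩, ?_⟩
    · rwa [Function.update_of_ne (by omega)]
    · rcases Nat.lt_succ_iff_lt_or_eq.1 hj with h | h
      · have hji : j ≠ i := fun e => by simp [e] at h
        have h1 : (j : ℕ) + 1 ≠ i + 1 := by omega
        have h2 : (j : ℕ) ≠ i + 1 := by omega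
        rw [Function.update_of_ne h1, Function.update_of_ne h2, Function.update_of_ne hji]
        exact hstep j h
      · have hji : j = i := Fin.ext h
        subst hji
        rw [Function.update_self, Function.update_self, Function.update_of_ne (by omega), hi]
        exact hq
    · refine Prod.ext rfl (funext fun j => ?_)
      by_cases h : j = i
      · subst h; cases b <;> simp [setBit, bitVector]
      · simp [setBit, bitVector, h]
  | zero => rw [map_zero]; exact zero_mem _
  | add p q _ _ hp hq => rw [map_add]; exact add_mem hp hq
  | smul a p _ hp =>
    have : setBit i b (a • p) = a • setBit i b p := (setBit i b).map_smul (a : ℝ) p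
    rw [this]; exact Submodule.smul_mem _ _ hp

variable [Fintype σ]

/-- The flow on the edges at position `i` that leave `q`. -/
noncomputable def outflow {n : ℕ} (i : Fin n) (q : σ) : (Edge σ n → ℝ) →ₗ[ℝ] ℝ :=
  ∑ b, ∑ q', LinearMap.proj (i, q, b, q')

/-- The flow on the edges at position `i` that enter `q`. -/
noncomputable def inflow {n : ℕ} (i : Fin n) (q : σ) : (Edge σ n → ℝ) →ₗ[ℝ] ℝ :=
  ∑ q₀, ∑ b, LinearMap.proj (i, q₀, b, q)

/-- The flow on the edges with letter `1` at each position. -/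
noncomputable def flowBits (σ : Type) [Fintype σ] (n : ℕ) :
    (Edge σ n → ℝ) →ₗ[ℝ] (Fin n → ℝ) :=
  LinearMap.pi fun i => ∑ q, ∑ q', LinearMap.proj (i, q, true, q')

/-- Unit flows from the start states to the accepting states. -/
structure IsUnitFlow {m : ℕ} (y : Edge σ (m + 1) → ℝ) : Prop where
  nonneg : ∀ e, 0 ≤ y e
  le_capacity : ∀ e, y e ≤ capacity M e
  total : ∑ q, outflow 0 q y = 1
  conservation : ∀ (i : Fin m) q, inflow i.castSucc q y = outflow i.succ q y

theorem outflow_apply {n : ℕ} (i : Fin n) (q : σ) (y : Edge σ n → ℝ) :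
    outflow i q y = ∑ b, ∑ q', y (i, q, b, q') := by
  simp [outflow]

theorem inflow_apply {n : ℕ} (i : Fin n) (q : σ) (y : Edge σ n → ℝ) :
    inflow i q y = ∑ q₀, ∑ b, y (i, q₀, b, q) := by
  simp [inflow]

theorem flowBits_apply {n : ℕ} (i : Fin n) (y : Edge σ n → ℝ) :
    flowBits σ n y i = ∑ q, ∑ q', y (i, q, true, q') := by
  simp [flowBits]

theorem sum_inflow_eq_sum_outflow {n : ℕ} (i : Fin n) (y : Edge σ n → ℝ) :
    ∑ q, inflow i q y = ∑ q, outflow i q y := by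
  simp only [inflow_apply, outflow_apply]
  rw [Finset.sum_comm]
  exact Finset.sum_congr rfl fun q _ => Finset.sum_comm

variable {M}

theorem IsUnitFlow.eq_zero {m : ℕ} {y : Edge σ (m + 1) → ℝ} (hy : IsUnitFlow M y)
    {e : Edge σ (m + 1)} (he : ¬ IsValidEdge M e) : y e = 0 :=
  le_antisymm (by simpa [capacity, he] using hy.le_capacity e) (hy.nonneg e)

theorem IsUnitFlow.outflow_nonneg {m : ℕ} {y : Edge σ (m + 1) → ℝ} (hy : IsUnitFlow M y)
    (i : Fin (m + 1)) (q : σ) : 0 ≤ outflow i q y := by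
  rw [outflow_apply]
  exact Finset.sum_nonneg fun b _ => Finset.sum_nonneg fun q' _ => hy.nonneg _

theorem IsUnitFlow.eq_zero_of_outflow {m : ℕ} {y : Edge σ (m + 1) → ℝ} (hy : IsUnitFlow M y)
    {i : Fin (m + 1)} {q : σ} (h : outflow i q y = 0) (b : Bool) (q' : σ) :
    y (i, q, b, q') = 0 := by
  rw [outflow_apply, Finset.sum_eq_zero_iff_of_nonneg
    fun b _ => Finset.sum_nonneg fun q' _ => hy.nonneg _] at h
  exact (Finset.sum_eq_zero_iff_of_nonneg fun q' _ => hy.nonneg _).1 (h b (Finset.mem_univ _)) q'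
    (Finset.mem_univ _)

/-- A distribution of the flow that arrives at the states at position `i` over the strings read
so far can be continued along the edges at position `i`. -/
theorem IsUnitFlow.exists_reachCone_step {m : ℕ} {y : Edge σ (m + 1) → ℝ} (hy : IsUnitFlow M y)
    (i : Fin (m + 1)) {z : σ → ℝ × (Fin (m + 1) → ℝ)} (hz : ∀ q, z q ∈ reachCone M (m + 1) i q)
    (hout : ∀ q, (z q).1 = outflow i q y)
    (hbits : ∀ j < i, ∑ q, (z q).2 j = flowBits σ (m + 1) y j) :
    ∃ z' : σ → ℝ × (Fin (m + 1) → ℝ), (∀ q, z' q ∈ reachCone M (m + 1) (i + 1) q) ∧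
      (∀ q, (z' q).1 = inflow i q y) ∧
      ∀ j ≤ i, ∑ q, (z' q).2 j = flowBits σ (m + 1) y j := by
  have hcancel : ∀ q b q', y (i, q, b, q') / outflow i q y * outflow i q y = y (i, q, b, q') :=
    fun q b q' => by
      by_cases h : outflow i q y = 0
      · rw [h, hy.eq_zero_of_outflow h, mul_zero]
      · exact div_mul_cancel₀ _ h
  -- Each edge takes the share of `z q` proportional to its flow. Where the outflow vanishes the
  -- quotient is `0`, in agreement with the flow on the edge.
  refine ⟨fun q' => ∑ q, ∑ b, (y (i, q, b, q') / outflow i q y) • setBit i b (z q),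
    fun q' => ?_, fun q' => ?_, fun j hj => ?_⟩
  · refine Submodule.sum_mem _ fun q _ => Submodule.sum_mem _ fun b _ => ?_
    by_cases h : q' ∈ M.step q b
    · exact Submodule.smul_mem _
        (⟨_, div_nonneg (hy.nonneg _) (hy.outflow_nonneg _ _)⟩ : {r : ℝ // 0 ≤ r})
        (setBit_mem_reachCone M h (hz q))
    · rw [hy.eq_zero fun hv => h hv.1, zero_div, zero_smul]
      exact zero_mem _
  · simp only [Prod.fst_sum, Prod.smul_fst, setBit, LinearMap.coe_mk, AddHom.coe_mk, smul_eq_mul,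
      hout, hcancel, inflow_apply]
  · simp only [Prod.snd_sum, Prod.smul_snd, Finset.sum_apply, Pi.smul_apply, setBit,
      LinearMap.coe_mk, AddHom.coe_mk, smul_eq_mul]
    rcases hj.lt_or_eq with hj | rfl
    · rw [← hbits j hj, Finset.sum_comm]
      refine Finset.sum_congr rfl fun q _ => ?_
      simp only [Function.update_of_ne hj.ne, ← Finset.sum_mul, ← Finset.sum_div]
      rw [Finset.sum_comm, ← outflow_apply]
      -- The shares add up to `1` unless the outflow is zero; then `z q` has height `0`, hence is
      -- `0`, and nothing is lost.
      by_cases h : outflow i q y = 0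
      · rcases eq_zero_or_of_mem_hull (hz q) with h0 | ⟨h0, -⟩
        · simp [h0]
        · rw [hout, h] at h0; exact absurd h0 (lt_irrefl _)
      · rw [div_self h, one_mul]
    · rw [flowBits_apply, Finset.sum_comm]
      refine Finset.sum_congr rfl fun q _ => Finset.sum_congr rfl fun q' _ => ?_
      simp [hout, hcancel]

theorem IsUnitFlow.exists_reachCone {m : ℕ} {y : Edge σ (m + 1) → ℝ} (hy : IsUnitFlow M y)
    (i : Fin (m + 1)) :
    ∃ z : σ → ℝ × (Fin (m + 1) → ℝ), (∀ q, z q ∈ reachCone M (m + 1) (i + 1) q) ∧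
      (∀ q, (z q).1 = inflow i q y) ∧ ∑ q, (z q).1 = 1 ∧
      ∀ j ≤ i, ∑ q, (z q).2 j = flowBits σ (m + 1) y j := by
  induction i using Fin.induction with
  | zero =>
    have h0 : ∀ q, (outflow 0 q y) • ((1 : ℝ), (0 : Fin (m + 1) → ℝ)) ∈
        reachCone M (m + 1) 0 q := by
      intro q
      by_cases hq : q ∈ M.start
      · refine Submodule.smul_mem _ (⟨_, hy.outflow_nonneg 0 q⟩ : {r : ℝ // 0 ≤ r})
          (Submodule.subset_span ⟨0, ⟨fun _ => false, ⟨fun _ => q, hq, rfl, fun j hj => ?_⟩, ?_⟩,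
            rfl⟩)
        · exact absurd hj (Nat.not_lt_zero _)
        · ext j; simp [bitVector]
      · have : outflow 0 q y = 0 := by
          rw [outflow_apply]
          exact Finset.sum_eq_zero fun b _ => Finset.sum_eq_zero fun q' _ =>
            hy.eq_zero fun hv => hq (hv.2.1 rfl)
        rw [this, zero_smul]
        exact zero_mem _
    obtain ⟨z, h1, h2, h3⟩ := hy.exists_reachCone_step 0 h0
      (fun q => by simp) (fun j hj => absurd hj (Fin.not_lt_zero j))
    refine ⟨z, h1, h2, ?_, h3⟩
    rw [← hy.total, ← sum_inflow_eq_sum_outflow]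
    exact Finset.sum_congr rfl fun q _ => h2 q
  | succ i ih =>
    obtain ⟨z, h1, h2, h3, h4⟩ := ih
    obtain ⟨z', h1', h2', h3'⟩ := hy.exists_reachCone_step i.succ (z := z)
      (by simpa using h1) (fun q => (h2 q).trans (hy.conservation i q))
      (fun j hj => h4 j (Fin.le_castSucc_iff.2 hj))
    refine ⟨z', h1', h2', ?_, h3'⟩
    rw [← h3, Finset.sum_congr rfl fun q _ => h2' q, sum_inflow_eq_sum_outflow]
    exact Finset.sum_congr rfl fun q _ => ((h2 q).trans (hy.conservation i q)).symm

/-- After the last layer only accepting states carry mass, because the edges into other states have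
capacity `0`. The sum over all states thus lies in the cone over the accepted strings, at height
`1`. -/
theorem IsUnitFlow.flowBits_mem {m : ℕ} {y : Edge σ (m + 1) → ℝ} (hy : IsUnitFlow M y) :
    flowBits σ (m + 1) y ∈ languagePolytope M.accepts (m + 1) := by
  obtain ⟨z, h1, h2, h3, h4⟩ := hy.exists_reachCone (Fin.last m)
  have hsum : flowBits σ (m + 1) y = (∑ q, z q).2 := by
    ext j
    rw [Prod.snd_sum, Finset.sum_apply, h4 j (Fin.le_last j)]
  rw [hsum]
  refine snd_mem_convexHull_of_mem_hull (Submodule.sum_mem _ fun q _ => ?_)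
    (by rw [Prod.fst_sum, h3])
  by_cases hq : q ∈ M.accept
  · refine Submodule.span_mono (Set.image_mono ?_) (h1 q)
    rintro _ ⟨x, ⟨β, hs, hβ, hstep⟩, rfl⟩
    exact ⟨x, (ofFn_mem_accepts_iff M x).2 ⟨β, hs, by rw [← hβ] at hq; exact hq,
      fun j => hstep j j.2⟩, rfl⟩
  · rcases eq_zero_or_of_mem_hull (h1 q) with h0 | ⟨h0, -⟩
    · rw [h0]; exact zero_mem _
    · rw [h2, inflow_apply] at h0
      refine absurd h0 (not_lt_of_ge (le_of_eq ?_))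
      exact Finset.sum_eq_zero fun q₀ _ => Finset.sum_eq_zero fun b _ =>
        hy.eq_zero fun hv => hq (hv.2.2 rfl)

/-- The flow is the indicator of the edges of one accepting run. -/
theorem exists_isUnitFlow {m : ℕ} {x : Fin (m + 1) → Bool} (hx : List.ofFn x ∈ M.accepts) :
    ∃ y, IsUnitFlow M y ∧ flowBits σ (m + 1) y = bitVector x := by
  classical
  obtain ⟨β, hs, ha, hstep⟩ := (ofFn_mem_accepts_iff M x).1 hx
  let y : Edge σ (m + 1) → ℝ := fun e =>
    if e.2.1 = β e.1 then if e.2.2.1 = x e.1 then if e.2.2.2 = β (e.1 + 1) then 1 else 0 else 0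
    else 0
  have hout : ∀ i q, outflow i q y = if q = β i then 1 else 0 := fun i q => by
    rw [outflow_apply]
    by_cases h : q = β i <;> simp [y, h]
  have hin : ∀ i q, inflow i q y = if q = β (i + 1) then 1 else 0 := fun i q => by
    rw [inflow_apply]
    simp [y]
  refine ⟨y, ⟨fun e => ?_, fun e => ?_, ?_, fun i q => ?_⟩, ?_⟩
  · dsimp only [y]
    split_ifs <;> norm_num
  · obtain ⟨i, q, b, q'⟩ := e
    by_cases h : q = β i ∧ b = x i ∧ q' = β (i + 1)
    · obtain ⟨rfl, rfl, rfl⟩ := h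
      have hv : IsValidEdge M (i, β i, x i, β (i + 1)) :=
        ⟨hstep i, fun h => by simpa [show i = 0 from h] using hs,
          fun h => by simpa [show i = Fin.last m from h] using ha⟩
      simp [y, capacity, hv]
    · have hy0 : y (i, q, b, q') = 0 := by
        dsimp only [y]
        split_ifs <;> tauto
      rw [hy0, capacity]
      split_ifs <;> norm_num
  · simp only [hout, Finset.sum_ite_eq', Finset.mem_univ, if_true]
  · rw [hout, hin]; simp
  · ext i
    rw [flowBits_apply]
    by_cases h : x i <;> simp [y, h, bitVector]

theorem flowBits_image_isUnitFlow (m : ℕ) :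
    flowBits σ (m + 1) '' {y | IsUnitFlow M y} = languagePolytope M.accepts (m + 1) := by
  refine Set.Subset.antisymm ?_ (convexHull_min ?_ ?_)
  · rintro _ ⟨y, hy, rfl⟩
    exact IsUnitFlow.flowBits_mem hy
  · rintro _ ⟨x, hx, rfl⟩
    exact exists_isUnitFlow hx
  · refine Convex.linear_image ?_ _
    intro y hy z hz a b ha hb hab
    refine ⟨fun e => ?_, fun e => ?_, ?_, fun i q => ?_⟩
    · exact add_nonneg (mul_nonneg ha (hy.nonneg e)) (mul_nonneg hb (hz.nonneg e))
    · calc a * y e + b * z e ≤ a * capacity M e + b * capacity M e :=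
          add_le_add (mul_le_mul_of_nonneg_left (hy.le_capacity e) ha)
            (mul_le_mul_of_nonneg_left (hz.le_capacity e) hb)
        _ = capacity M e := by rw [← add_mul, hab, one_mul]
    · simp only [map_add, map_smul, smul_eq_mul, Finset.sum_add_distrib, ← Finset.mul_sum,
        hy.total, hz.total, mul_one, hab]
    · simp only [map_add, map_smul, hy.conservation, hz.conservation]

/-- The index type of the inequalities that define the unit flows. -/
abbrev FlowConstraint (σ : Type) (m : ℕ) : Type :=
  (Edge σ (m + 1) × Bool) ⊕ Bool ⊕ (Fin m × σ × Bool)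

variable (M)

/-- The polytope of the strings of length `n` that an automaton accepts has an extended
formulation of size polynomial in `n` and in the number of states. -/
theorem extensionComplexity_accepts_le (m : ℕ) :
    extensionComplexity (languagePolytope M.accepts (m + 1)) ≤
      (((m + 1) * Fintype.card σ * 2 * Fintype.card σ * 2 + (2 + m * Fintype.card σ * 2) : ℕ) : ℕ∞)
      := by
  -- The Boolean index selects one of two opposite inequalities: the bounds on an edge, or the two
  -- halves of an equation.
  let f : FlowConstraint σ m → (Edge σ (m + 1) → ℝ) →ₗ[ℝ] ℝ := fun k => match k with
    | .inl (e, true) => LinearMap.proj e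
    | .inl (e, false) => -LinearMap.proj e
    | .inr (.inl true) => ∑ q, outflow 0 q
    | .inr (.inl false) => -∑ q, outflow 0 q
    | .inr (.inr (i, q, true)) => inflow i.castSucc q - outflow i.succ q
    | .inr (.inr (i, q, false)) => outflow i.succ q - inflow i.castSucc q
  let b : FlowConstraint σ m → ℝ := fun k => match k with
    | .inl (e, true) => capacity M e
    | .inr (.inl true) => 1
    | .inr (.inl false) => -1
    | _ => 0
  have hiff : ∀ y, (∀ k, f k y ≤ b k) ↔ IsUnitFlow M y := by
    intro y
    constructor
    · intro h
      refine ⟨fun e => ?_, fun e => h (.inl (e, true)), le_antisymm ?_ ?_, fun i q =>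
        le_antisymm ?_ ?_⟩
      · simpa [f, b] using h (.inl (e, false))
      · simpa [f, b] using h (.inr (.inl true))
      · simpa [f, b] using h (.inr (.inl false))
      · simpa [f, b] using h (.inr (.inr (i, q, true)))
      · simpa [f, b] using h (.inr (.inr (i, q, false)))
    · rintro h (⟨e, _ | _⟩ | (_ | _) | ⟨i, q, _ | _⟩)
      · simpa [f, b] using h.nonneg e
      · exact h.le_capacity e
      · simpa [f, b] using h.total.ge
      · simpa [f, b] using h.total.le
      · simpa [f, b] using (h.conservation i q).ge
      · simpa [f, b] using (h.conservation i q).le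
  have h := extensionComplexity_le_card f b (flowBits σ (m + 1)) fun y hy e => by
    have hy := (hiff y).1 hy
    rw [abs_of_nonneg (hy.nonneg e)]
    refine (hy.le_capacity e).trans ?_
    rw [capacity]
    split_ifs <;> norm_num
  simp only [hiff, flowBits_image_isUnitFlow] at h
  refine h.trans (le_of_eq ?_)
  simp only [Fintype.card_sum, Fintype.card_prod, Fintype.card_fin, Fintype.card_bool]
  congr 1
  ring

end NFAPolytope

/-! ### Cutting computations into passes and gluing them back -/

namespace OnlineNTM

variable (M : OnlineNTM)

/-- The part of a configuration that does not refer to the input: the state, the content of the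
work tape and the position of the work head. -/
abbrev Memory : Type := M.State × (ℕ → M.Symbol) × ℕ

/-- The memory contents that use only the first `s` cells of the work tape. -/
def BoundedMemory (s : ℕ) : Type :=
  {m : M.Memory // m.2.2 < s ∧ ∀ j, s ≤ j → m.2.1 j = M.blank}

variable {M}

/-- The configuration with given memory content, input position and pass. -/
def Memory.config (m : M.Memory) (i p : ℕ) : M.Config := ⟨m.1, i, p, m.2.1, m.2.2⟩

/-- The memory content after an action. -/
def Memory.act (m : M.Memory) (a : M.State × M.Symbol × InputMove × WorkMove) : M.Memory :=
  (a.1, Function.update m.2.1 m.2.2 a.2.1, moveWork m.2.2 a.2.2.2)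

/-- The actions that are possible when the input head reads `a`. -/
def Memory.actions (m : M.Memory) (a : Option Bool) :
    Set (M.State × M.Symbol × InputMove × WorkMove) :=
  M.next m.1 a (m.2.1 m.2.2)

variable (M)

/-- The status of a pass over the input when it reaches a cell: it is running with some memory
content, or it has ended before with a restart (`some m`, the next pass starts from `m`) or with
acceptance (`none`). -/
abbrev PassStatus (s : ℕ) : Type := M.BoundedMemory s ⊕ Option (M.BoundedMemory s)

variable {M} {s : ℕ}

/-- The possible changes of the status of a pass at a cell of the input with symbol `a`. -/
inductive Cell (a : Option Bool) : M.PassStatus s → M.PassStatus s → Prop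
  | finished (r) : Cell a (.inr r) (.inr r)
  | accept {m : M.BoundedMemory s} (halt : m.1.actions a = ∅) (acc : m.1.1 ∈ M.accepting) :
      Cell a (.inl m) (.inr none)
  | stay {m m' : M.BoundedMemory s} {c r} (hc : c ∈ m.1.actions a) (hm : m'.1 = m.1.act c)
      (move : c.2.2.1 = .stay ∨ c.2.2.1 = .right ∧ a = none) (rest : Cell a (.inl m') r) :
      Cell a (.inl m) r
  | right {m m' : M.BoundedMemory s} {c} (hc : c ∈ m.1.actions a) (hm : m'.1 = m.1.act c)
      (move : c.2.2.1 = .right) (ha : a ≠ none) : Cell a (.inl m) (.inl m')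
  | restart {m m' : M.BoundedMemory s} {c} (hc : c ∈ m.1.actions a) (hm : m'.1 = m.1.act c)
      (move : c.2.2.1 = .restart) : Cell a (.inl m) (.inr (some m'))

/-- The possible changes of the status of a pass over a suffix of the input, including the end
marker. -/
def Pass : List Bool → M.PassStatus s → M.PassStatus s → Prop
  | [], b, b' => Cell none b b'
  | a :: l, b, b' => ∃ d, Cell (some a) b d ∧ Pass l d b'

/-- The status of a pass on the first cell, given the outcome of the previous pass. -/
def entry : Option (M.BoundedMemory s) → M.PassStatus s
  | some m => .inl m
  | none => .inr none

/-- From the outcome `r` of the previous pass, acceptance is reached in `k` more passes. -/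
def Passes (x : List Bool) : ℕ → Option (M.BoundedMemory s) → Prop
  | 0, r => r = none
  | k + 1, r => ∃ r', Pass x (entry r) (.inr r') ∧ Passes x k r'

theorem pass_finished (l : List Bool) (r : Option (M.BoundedMemory s)) :
    Pass l (.inr r) (.inr r) := by
  induction l with
  | nil => exact .finished r
  | cons a l ih => exact ⟨_, .finished r, ih⟩

/-- Early acceptance is padded with idle passes, so exactly `k` passes can be demanded. -/
theorem passes_none (x : List Bool) (k : ℕ) : Passes x k (none : Option (M.BoundedMemory s)) := by
  induction k with
  | zero => rfl
  | succ k ih => exact ⟨none, pass_finished x none, ih⟩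

theorem drop_eq_nil_or_cons (x : List Bool) (i : ℕ) :
    x[i]? = none ∧ x.drop i = [] ∨ ∃ a, x[i]? = some a ∧ x.drop i = a :: x.drop (i + 1) := by
  rcases lt_or_ge i x.length with h | h
  · exact Or.inr ⟨x[i], List.getElem?_eq_getElem h, List.drop_eq_getElem_cons h⟩
  · exact Or.inl ⟨List.getElem?_eq_none h, List.drop_eq_nil_of_le h⟩

/-- A pass depends on its initial status only through the behaviour at the current cell; this allows
steps that do not leave the cell to be prepended. -/
theorem pass_drop_mono {x : List Bool} {i : ℕ} {b b' r : M.PassStatus s}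
    (h : ∀ d, Cell x[i]? b' d → Cell x[i]? b d) (hp : Pass (x.drop i) b' r) :
    Pass (x.drop i) b r := by
  rcases drop_eq_nil_or_cons x i with ⟨hn, hd⟩ | ⟨a, hn, hd⟩
  · rw [hd] at hp ⊢
    rw [hn] at h
    exact h _ hp
  · rw [hd] at hp ⊢
    rw [hn] at h
    obtain ⟨d, h1, h2⟩ := hp
    exact ⟨d, h d h1, h2⟩

theorem pass_drop_of_cell {x : List Bool} {i : ℕ} {b : M.PassStatus s}
    {r : Option (M.BoundedMemory s)} (h : Cell x[i]? b (.inr r)) :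
    Pass (x.drop i) b (.inr r) := by
  refine pass_drop_mono (b' := .inr r) (fun d hd => ?_) (pass_finished _ r)
  cases hd
  exact h

/-- A bounded accepting computation can be cut into passes. -/
theorem exists_pass_of_run {x : List Bool} {k t : ℕ} {c : ℕ → M.Config} {m : M.BoundedMemory s}
    {i p : ℕ} (h0 : c 0 = m.1.config i p) (hi : i ≤ x.length)
    (hstep : ∀ j < t, M.Step x (c j) (c (j + 1))) (hhalt : M.actions x (c t) = ∅)
    (hacc : (c t).state ∈ M.accepting) (hbd : ∀ j ≤ t, (c j).pass ≤ k ∧ (c j).head < s) :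
    ∃ r, Pass (x.drop i) (.inl m) (.inr r) ∧ Passes x (k - p) r := by
  induction t generalizing c m i p with
  | zero =>
    rw [h0] at hhalt hacc
    exact ⟨none, pass_drop_of_cell (.accept hhalt hacc), passes_none _ _⟩
  | succ t ih =>
    obtain ⟨a, ha, hc1⟩ := hstep 0 t.succ_pos
    rw [h0] at ha hc1
    have hb1 := hbd 1 (by omega)
    rw [zero_add] at hc1
    have hb : (m.1.act a).2.2 < s ∧ ∀ j, s ≤ j → (m.1.act a).2.1 j = M.blank := by
      refine ⟨?_, fun j hj => ?_⟩
      · have := hb1.2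
        rw [hc1] at this
        exact this
      -- The write happens under the head, which is below `s`, so the cells from `s` on stay blank.
      · have hne : j ≠ m.1.2.2 := by have := m.2.1; omega
        exact (Function.update_of_ne hne _ _).trans (m.2.2 j hj)
    let m' : M.BoundedMemory s := ⟨m.1.act a, hb⟩
    have hc1' : c (0 + 1) = m'.1.config (moveInput x.length i a.2.2.1) (movePass p a.2.2.1) := hc1
    have ih := @ih (fun j => c (j + 1)) m' _ _ hc1'
    cases hmv : a.2.2.1 with
    | stay =>
      rw [hmv] at ih
      obtain ⟨r, h1, h2⟩ := ih hi (fun j hj => hstep (j + 1) (by omega)) hhalt hacc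
        (fun j hj => hbd (j + 1) (by omega))
      exact ⟨r, pass_drop_mono (fun d hd => .stay ha rfl (Or.inl hmv) hd) h1, h2⟩
    | right =>
      rw [hmv] at ih
      obtain ⟨r, h1, h2⟩ := ih (min_le_right _ _) (fun j hj => hstep (j + 1) (by omega)) hhalt hacc
        (fun j hj => hbd (j + 1) (by omega))
      refine ⟨r, ?_, h2⟩
      rcases hi.lt_or_eq with hi | rfl
      · have he : moveInput x.length i .right = i + 1 := min_eq_left hi
        rw [he] at h1
        rw [List.drop_eq_getElem_cons hi]
        have hx : x[i]? = some x[i] := List.getElem?_eq_getElem hi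
        refine ⟨.inl m', .right (c := a) ?_ rfl hmv (by simp), h1⟩
        rw [← hx]; exact ha
      -- On the end marker a move to the right does not move the head and counts as `stay`.
      · have he : moveInput x.length x.length .right = x.length := min_eq_right (by omega)
        rw [he] at h1
        exact pass_drop_mono (fun d hd => .stay ha rfl (Or.inr ⟨hmv, by simp⟩) hd) h1
    | restart =>
      rw [hmv] at ih
      obtain ⟨r, h1, h2⟩ := ih (Nat.zero_le _) (fun j hj => hstep (j + 1) (by omega)) hhalt hacc
        (fun j hj => hbd (j + 1) (by omega))
      refine ⟨some m', pass_drop_of_cell (.restart ha rfl hmv), ?_⟩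
      -- The pass bound after the restart ensures that the truncated difference `k - p` is positive,
      -- so a pass is left to spend.
      have hp : p + 1 ≤ k := by
        have := hb1.1
        rw [hc1] at this
        simpa [perform, movePass, hmv, Memory.config] using this
      obtain ⟨q, hq⟩ : ∃ q, k - p = q + 1 := ⟨k - (p + 1), by omega⟩
      rw [hq]
      have hq' : k - movePass p .restart = q := by
        change k - (p + 1) = q
        omega
      rw [hq'] at h2
      exact ⟨r, h1, h2⟩

variable (M)

/-- Some accepting computation on `x` starts in the configuration `c`. -/
def AcceptsFrom (x : List Bool) (c : M.Config) : Prop :=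
  ∃ (t : ℕ) (f : ℕ → M.Config), f 0 = c ∧ (∀ i < t, M.Step x (f i) (f (i + 1))) ∧
    M.actions x (f t) = ∅ ∧ (f t).state ∈ M.accepting

variable {M}

theorem AcceptsFrom.of_step {x : List Bool} {c c' : M.Config} (h : M.Step x c c')
    (h' : M.AcceptsFrom x c') : M.AcceptsFrom x c := by
  obtain ⟨t, f, rfl, hf, h1, h2⟩ := h'
  refine ⟨t + 1, fun j => Nat.casesOn j c f, rfl, fun i hi => ?_, h1, h2⟩
  cases i with
  | zero => exact h
  | succ i => exact hf i (by omega)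

/-- A pass that reaches cell `i` of the input `x` with the given status leads to acceptance. -/
def LeadsToAcceptance (x : List Bool) (i : ℕ) : M.PassStatus s → Prop
  | .inl m => ∀ p, M.AcceptsFrom x (m.1.config i p)
  | .inr (some m) => ∀ p, M.AcceptsFrom x (m.1.config 0 p)
  | .inr none => True

/-- The possible actions ignore the pass counter, so acceptance can be claimed for every `p` and the
steps at the cell prepended one by one. -/
theorem LeadsToAcceptance.of_cell {x : List Bool} {i : ℕ} (hi : i ≤ x.length)
    {b b' : M.PassStatus s} (h : Cell x[i]? b b') (h' : LeadsToAcceptance x (i + 1) b') :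
    LeadsToAcceptance x i b := by
  induction h with
  | finished r => cases r <;> exact h'
  | accept halt acc => exact fun p => ⟨0, fun _ => _, rfl, by simp, halt, acc⟩
  | @stay m m' c r hc hm move rest ih =>
    refine fun p => .of_step ⟨c, hc, rfl⟩ ?_
    have := ih h' (movePass p c.2.2.1)
    have he : moveInput x.length i c.2.2.1 = i := by
      rcases move with h | ⟨h, ha⟩
      · rw [h]; rfl
      · rw [h]
        have := List.getElem?_eq_none_iff.1 ha
        exact (min_eq_right (by omega)).trans (by omega)
    rw [hm] at this
    convert this using 1
    simp [perform, Memory.config, Memory.act, he]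
  | @right m m' c hc hm move ha =>
    refine fun p => .of_step ⟨c, hc, rfl⟩ ?_
    have := h' (movePass p c.2.2.1)
    have he : moveInput x.length i c.2.2.1 = i + 1 := by
      rw [move]
      have : ¬ x.length ≤ i := fun h => ha (List.getElem?_eq_none h)
      exact min_eq_left (by omega)
    rw [hm] at this
    convert this using 1
    simp [perform, Memory.config, Memory.act, he]
  | @restart m m' c hc hm move =>
    refine fun p => .of_step ⟨c, hc, rfl⟩ ?_
    have := h' (movePass p c.2.2.1)
    rw [hm] at this
    convert this using 1
    simp [perform, Memory.config, Memory.act, move, moveInput]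

theorem LeadsToAcceptance.of_pass {x l : List Bool} {i : ℕ} (hi : i ≤ x.length)
    (hl : x.drop i = l) {b : M.PassStatus s} {r : Option (M.BoundedMemory s)}
    (h : Pass l b (.inr r)) (h' : ∀ j, LeadsToAcceptance x j (.inr r)) :
    LeadsToAcceptance x i b := by
  induction l generalizing i b with
  | nil =>
    rcases drop_eq_nil_or_cons x i with ⟨hn, -⟩ | ⟨a, -, hd⟩
    · refine .of_cell hi ?_ (h' _)
      rw [hn]; exact h
    · simp [hl] at hd
  | cons a l ih =>
    rcases drop_eq_nil_or_cons x i with ⟨-, hd⟩ | ⟨a', hn, hd⟩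
    · simp [hl] at hd
    · rw [hl, List.cons.injEq] at hd
      obtain ⟨rfl, rfl⟩ := hd
      obtain ⟨d, h1, h2⟩ := h
      refine .of_cell hi (b' := d) (by rw [hn]; exact h1) (ih ?_ rfl h2)
      by_contra hlt
      rw [List.getElem?_eq_none (by omega)] at hn
      cases hn

theorem LeadsToAcceptance.of_passes {x : List Bool} {k : ℕ} {r : Option (M.BoundedMemory s)}
    (h : Passes x k r) (j : ℕ) : LeadsToAcceptance x j (.inr r) := by
  induction k generalizing r j with
  | zero => rw [show r = none from h]; trivial
  | succ k ih =>
    obtain ⟨r', h1, h2⟩ := h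
    have := LeadsToAcceptance.of_pass (Nat.zero_le _) List.drop_zero h1 (ih h2)
    cases r with
    | none => trivial
    | some m => exact this

variable (M) in
/-- The memory content of the initial configuration. -/
def initialMemory : M.Memory := (M.start, fun _ => M.blank, 0)

theorem accepts_of_passes {x : List Bool} {k : ℕ} {m : M.BoundedMemory s}
    (hm : m.1 = M.initialMemory) (h : Passes x k (some m)) : M.Accepts x := by
  have := LeadsToAcceptance.of_passes h 0 1
  rw [hm] at this
  exact this

theorem exists_passes_of_acceptsWithin {x : List Bool} {k : ℕ} (h : M.AcceptsWithin x k s) :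
    ∃ m : M.BoundedMemory s, m.1 = M.initialMemory ∧ Passes x k (some m) := by
  obtain ⟨t, c, ⟨h0, hstep, hhalt, hacc⟩, hbd⟩ := h
  have hb := hbd 0 (Nat.zero_le t)
  rw [h0] at hb
  let m : M.BoundedMemory s := ⟨M.initialMemory, hb.2, fun _ _ => rfl⟩
  obtain ⟨r, h1, h2⟩ := exists_pass_of_run (m := m) (i := 0) (p := 1) h0 (Nat.zero_le _) hstep hhalt
    hacc hbd
  refine ⟨m, rfl, ?_⟩
  -- Passes are counted from `1`, so the bound at time `0` forces `1 ≤ k`.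
  obtain ⟨q, rfl⟩ : ∃ q, k = q + 1 := ⟨k - 1, by have := hb.1; simp only [initial] at this; omega⟩
  exact ⟨r, h1, h2⟩

theorem passes_iff {x : List Bool} {k : ℕ} {r : Option (M.BoundedMemory s)} :
    Passes x k r ↔ ∃ G : Fin (k + 1) → Option (M.BoundedMemory s), G 0 = r ∧
      G (Fin.last k) = none ∧ ∀ p : Fin k, Pass x (entry (G p.castSucc)) (.inr (G p.succ)) := by
  induction k generalizing r with
  | zero =>
    exact ⟨fun h => ⟨fun _ => r, rfl, h, fun p => p.elim0⟩, fun ⟨G, h0, h1, _⟩ => h0.symm.trans h1⟩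
  | succ k ih =>
    constructor
    · rintro ⟨r', h1, h2⟩
      obtain ⟨G, rfl, hl, hG⟩ := ih.1 h2
      refine ⟨Fin.cons r G, rfl, ?_, fun p => ?_⟩
      · rw [← Fin.succ_last, Fin.cons_succ, hl]
      · refine Fin.cases ?_ (fun p => ?_) p
        · exact h1
        · exact hG p
    · rintro ⟨G, rfl, hl, hG⟩
      exact ⟨G 1, hG 0, ih.2 ⟨fun p => G p.succ, rfl, hl, fun p => hG p.succ⟩⟩

/-! ### The automaton that runs all passes in parallel -/

variable (M) (s) in
/-- The states of the automaton that simulates `k` passes at once: the guessed outcomes of the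
passes, and the status of each pass at the current cell. -/
abbrev PassAutomatonState (k : ℕ) : Type :=
  (Fin (k + 1) → Option (M.BoundedMemory s)) × (Fin k → M.PassStatus s)

variable (M) (s) in
/-- The automaton that guesses the memory contents between `k` passes and then simulates these
passes at once. -/
def passAutomaton (k : ℕ) : NFA Bool (M.PassAutomatonState s k) where
  step v b := {w | w.1 = v.1 ∧ ∀ p, Cell (some b) (v.2 p) (w.2 p)}
  start := {v | (∃ m, v.1 0 = some m ∧ m.1 = M.initialMemory) ∧
    ∀ p, v.2 p = entry (v.1 p.castSucc)}
  accept := {v | v.1 (Fin.last k) = none ∧ ∀ p, Cell none (v.2 p) (.inr (v.1 p.succ))}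

/-- The guess `v.1` never changes along a run and the coordinates of `v.2` move independently, so a
run is just a tuple of passes. -/
theorem mem_acceptsFrom_passAutomaton_iff {k : ℕ} (x : List Bool) (v : M.PassAutomatonState s k) :
    x ∈ (M.passAutomaton s k).acceptsFrom {v} ↔
      v.1 (Fin.last k) = none ∧ ∀ p, Pass x (v.2 p) (.inr (v.1 p.succ)) := by
  induction x generalizing v with
  | nil => simp only [NFA.nil_mem_acceptsFrom, Set.mem_singleton_iff, exists_eq_left]; rfl
  | cons a x ih =>
    rw [NFA.cons_mem_acceptsFrom, NFA.stepSet_singleton, NFA.mem_acceptsFrom]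
    constructor
    · rintro ⟨t, ht, h⟩
      obtain ⟨w, ⟨hw1, hw2⟩, h⟩ := NFA.mem_evalFrom_iff_exists.1 h
      have := (ih w).1 ⟨t, ht, h⟩
      rw [hw1] at this
      exact ⟨this.1, fun p => ⟨_, hw2 p, this.2 p⟩⟩
    · rintro ⟨hl, h⟩
      choose d h1 h2 using h
      obtain ⟨t, ht, h⟩ := (ih (v.1, d)).2 ⟨hl, h2⟩
      exact ⟨t, ht, NFA.mem_evalFrom_iff_exists.2 ⟨(v.1, d), ⟨rfl, h1⟩, h⟩⟩

theorem mem_accepts_passAutomaton_iff {k : ℕ} (x : List Bool) :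
    x ∈ (M.passAutomaton s k).accepts ↔
      ∃ m : M.BoundedMemory s, m.1 = M.initialMemory ∧ Passes x k (some m) := by
  have h : x ∈ (M.passAutomaton s k).accepts ↔ ∃ v ∈ (M.passAutomaton s k).start,
      x ∈ (M.passAutomaton s k).acceptsFrom {v} := by
    simp only [NFA.mem_accepts, NFA.mem_acceptsFrom,
      NFA.mem_evalFrom_iff_exists (S := (M.passAutomaton s k).start)]
    tauto
  rw [h]
  constructor
  · rintro ⟨v, ⟨⟨m, hv, hm⟩, hentry⟩, hx⟩
    rw [mem_acceptsFrom_passAutomaton_iff] at hx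
    exact ⟨m, hm, passes_iff.2 ⟨v.1, hv, hx.1, fun p => hentry p ▸ hx.2 p⟩⟩
  · rintro ⟨m, hm, hp⟩
    obtain ⟨G, h0, hl, hG⟩ := passes_iff.1 hp
    exact ⟨(G, fun p => entry (G p.castSucc)), ⟨⟨m, h0, hm⟩, fun _ => rfl⟩,
      (mem_acceptsFrom_passAutomaton_iff x _).2 ⟨hl, hG⟩⟩

/-! ### Counting the states -/

/-- The restriction of a bounded memory content to the cells in use. -/
def BoundedMemory.restrict (m : M.BoundedMemory s) : M.State × (Fin s → M.Symbol) × Fin s :=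
  (m.1.1, fun j => m.1.2.1 j, ⟨m.1.2.2, m.2.1⟩)

theorem BoundedMemory.restrict_injective :
    Function.Injective (BoundedMemory.restrict : M.BoundedMemory s → _) := by
  intro m m' h
  simp only [restrict, Prod.mk.injEq, Fin.mk.injEq] at h
  refine Subtype.ext (Prod.ext h.1 (Prod.ext (funext fun j => ?_) h.2.2))
  rcases lt_or_ge j s with hj | hj
  · exact congrFun h.2.1 ⟨j, hj⟩
  · rw [m.2.2 j hj, m'.2.2 j hj]

instance : Finite (M.BoundedMemory s) :=
  have := M.finiteState
  have := M.finiteSymbol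
  Finite.of_injective _ BoundedMemory.restrict_injective

variable (M) (s) in
theorem card_boundedMemory_le :
    Nat.card (M.BoundedMemory s) ≤ Nat.card M.State * (Nat.card M.Symbol ^ s * s) := by
  have := M.finiteState
  have := M.finiteSymbol
  refine (Nat.card_le_card_of_injective _ BoundedMemory.restrict_injective).trans (le_of_eq ?_)
  simp [Nat.card_prod, Nat.card_fun]

variable (M) (s) in
theorem card_passAutomatonState (k : ℕ) :
    Nat.card (M.PassAutomatonState s k) = (Nat.card (M.BoundedMemory s) + 1) ^ (k + 1) *
      (Nat.card (M.BoundedMemory s) + (Nat.card (M.BoundedMemory s) + 1)) ^ k := by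
  simp [Nat.card_prod, Nat.card_fun, Nat.card_sum, Finite.card_option]

end OnlineNTM

/-! ### Polynomial growth -/

open Filter in
/-- `f n` is at most a fixed power of `n` for all sufficiently large `n`. -/
def EventuallyPolynomial (f : ℕ → ℕ) : Prop := ∃ c : ℕ, ∀ᶠ n in atTop, f n ≤ n ^ c

namespace EventuallyPolynomial

variable {f g : ℕ → ℕ}

theorem mono (hg : EventuallyPolynomial g) (h : ∀ n, f n ≤ g n) : EventuallyPolynomial f :=
  hg.imp fun _ hc => hc.mono fun n hn => (h n).trans hn

theorem const (a : ℕ) : EventuallyPolynomial fun _ => a :=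
  ⟨1, (Filter.eventually_ge_atTop a).mono fun n hn => by simpa using hn⟩

theorem id : EventuallyPolynomial fun n => n := ⟨1, .of_forall fun n => by simp⟩

theorem mul (hf : EventuallyPolynomial f) (hg : EventuallyPolynomial g) :
    EventuallyPolynomial fun n => f n * g n := by
  obtain ⟨c, hc⟩ := hf
  obtain ⟨d, hd⟩ := hg
  exact ⟨c + d, (hc.and hd).mono fun n hn => by rw [pow_add]; exact Nat.mul_le_mul hn.1 hn.2⟩

theorem add (hf : EventuallyPolynomial f) (hg : EventuallyPolynomial g) :
    EventuallyPolynomial fun n => f n + g n := by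
  obtain ⟨c, hc⟩ := hf
  obtain ⟨d, hd⟩ := hg
  refine ⟨c + d + 1, ?_⟩
  filter_upwards [hc, hd, Filter.eventually_ge_atTop 2] with n hcn hdn hn
  have h1 : n ^ c ≤ n ^ (c + d) := Nat.pow_le_pow_right (by omega) (by omega)
  have h2 : n ^ d ≤ n ^ (c + d) := Nat.pow_le_pow_right (by omega) (by omega)
  calc f n + g n ≤ n ^ (c + d) * 2 := by omega
    _ ≤ n ^ (c + d + 1) := by rw [pow_succ]; exact Nat.mul_le_mul_left _ hn

theorem pow (hf : EventuallyPolynomial f) (k : ℕ) : EventuallyPolynomial fun n => f n ^ k := by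
  obtain ⟨c, hc⟩ := hf
  exact ⟨c * k, hc.mono fun n hn => by rw [pow_mul]; exact Nat.pow_le_pow_left hn k⟩

theorem exp_of_isBigO_log {s : ℕ → ℕ} (a : ℕ)
    (hs : (fun n : ℕ => (s n : ℝ)) =O[Filter.atTop] (fun n : ℕ => Real.log (n : ℝ))) :
    EventuallyPolynomial fun n => a ^ s n := by
  obtain ⟨C, hC⟩ := hs.bound
  -- From `a ^ s ≤ exp (s * log (a + 1))` and `s ≤ C * log n`. The shift to `a + 1` keeps the
  -- logarithm nonnegative and covers `a = 0`.
  refine ⟨⌈C * Real.log (a + 1)⌉₊, ?_⟩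
  filter_upwards [hC, Filter.eventually_ge_atTop 1] with n hn hn1
  have hn1 : (1 : ℝ) ≤ n := by exact_mod_cast hn1
  have hlog : 0 ≤ Real.log n := Real.log_nonneg hn1
  rw [Real.norm_of_nonneg (Nat.cast_nonneg _), Real.norm_of_nonneg hlog] at hn
  have ha : (0 : ℝ) < (a : ℝ) + 1 := by positivity
  have hloga : 0 ≤ Real.log ((a : ℝ) + 1) := Real.log_nonneg (by simp)
  have key : ((a : ℝ) ^ s n) ≤ (n : ℝ) ^ ⌈C * Real.log (a + 1)⌉₊ := by
    calc (a : ℝ) ^ s n ≤ ((a : ℝ) + 1) ^ s n := pow_le_pow_left₀ (by positivity) (by simp) _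
      _ = Real.exp (s n * Real.log (a + 1)) := by rw [Real.exp_nat_mul, Real.exp_log ha]
      _ ≤ Real.exp (⌈C * Real.log (a + 1)⌉₊ * Real.log n) := by
        refine Real.exp_le_exp.2 ?_
        calc s n * Real.log (a + 1) ≤ C * Real.log n * Real.log (a + 1) :=
              mul_le_mul_of_nonneg_right hn hloga
          _ = C * Real.log (a + 1) * Real.log n := by ring
          _ ≤ _ := mul_le_mul_of_nonneg_right (Nat.le_ceil _) hlog
      _ = (n : ℝ) ^ ⌈C * Real.log (a + 1)⌉₊ := by
        rw [Real.exp_nat_mul, Real.exp_log (by linarith)]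
  exact_mod_cast key

end EventuallyPolynomial

/-! ### The corollary -/

open OnlineNTM EventuallyPolynomial in
/-- Languages accepted in a fixed number of passes and logarithmic space have compact extended
formulations. -/
theorem mem_CF_of_mem_NSPACE {L : Language Bool} {k : ℕ} {s : ℕ → ℕ}
    (hs : (fun n : ℕ => (s n : ℝ)) =O[Filter.atTop] (fun n : ℕ => Real.log (n : ℝ)))
    (hL : L ∈ NSPACE k s) : L ∈ CF := by
  obtain ⟨M, hacc, hwithin⟩ := hL
  have hexp := exp_of_isBigO_log (Nat.card M.Symbol) hs
  have hspace : EventuallyPolynomial s :=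
    (exp_of_isBigO_log 2 hs).mono fun n => Nat.lt_two_pow_self.le
  have hmem : EventuallyPolynomial fun n => Nat.card (M.BoundedMemory (s n)) :=
    ((const _).mul (hexp.mul hspace)).mono fun n => M.card_boundedMemory_le (s n)
  have hstates : EventuallyPolynomial fun n => Nat.card (M.PassAutomatonState (s n) k) := by
    simp only [card_passAutomatonState]
    exact ((hmem.add (const 1)).pow _).mul ((hmem.add (hmem.add (const 1))).pow _)
  -- This has the shape of the bound in `extensionComplexity_accepts_le`, with `n` in place of both
  -- `m + 1` and `m`.
  obtain ⟨c, hc⟩ := (((((id.mul hstates).mul (const 2)).mul hstates).mul (const 2)).add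
    ((const 2).add ((id.mul hstates).mul (const 2))))
  obtain ⟨n₀, hn₀⟩ := Filter.eventually_atTop.1 hc
  -- `c + 1` makes the exponent positive; `n₀ + 1` excludes length `0`, where there are no layers.
  refine ⟨c + 1, c.succ_pos, n₀ + 1, fun n hn => ?_⟩
  obtain ⟨m, rfl⟩ : ∃ m, n = m + 1 := ⟨n - 1, by omega⟩
  have hlang : languagePolytope L (m + 1) =
      languagePolytope (M.passAutomaton (s (m + 1)) k).accepts (m + 1) := by
    have hiff : ∀ x : Fin (m + 1) → Bool, List.ofFn x ∈ L ↔
        List.ofFn x ∈ (M.passAutomaton (s (m + 1)) k).accepts := fun x => by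
      rw [mem_accepts_passAutomaton_iff]
      constructor
      · intro hx
        have := hwithin _ hx
        rw [List.length_ofFn] at this
        exact exists_passes_of_acceptsWithin this
      · rintro ⟨i, hi, hp⟩
        exact (hacc _).2 (accepts_of_passes hi hp)
    simp only [languagePolytope, hiff]
  have := Fintype.ofFinite (M.PassAutomatonState (s (m + 1)) k)
  rw [hlang]
  refine (extensionComplexity_accepts_le _ m).trans (Nat.cast_le.2 ?_)
  rw [← Nat.card_eq_fintype_card]
  refine le_trans ?_ ((hn₀ (m + 1) (by omega)).trans (Nat.pow_le_pow_right m.succ_pos c.le_succ))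
  exact Nat.add_le_add_left (Nat.add_le_add_left (Nat.mul_le_mul_right _
    (Nat.mul_le_mul_right _ m.le_succ)) _) _

end CompactEF

theorem mainTheorem3 (L : Language Bool) (k : ℕ) (s : ℕ → ℕ)
    (hs : (fun n : ℕ => (s n : ℝ)) =O[Filter.atTop] (fun n : ℕ => Real.log (n : ℝ)))
    (hL : L ∈ CompactEF.NSPACE k s) : L ∈ CompactEF.CF :=
  CompactEF.mem_CF_of_mem_NSPACE hs hL
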